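/- Let $\mathcal A$ be a von Neumann algebra with a faithful normal tracial state $\tau$, and let $\|x\|_2=\tau(x^*x)^{1/2}$. Let $\Sigma$ be the set of positive invertible elements of $\mathcal A$, with the metric $\langle x,y\rangle_a=\tau(xa^{-1}ya^{-1})$ for $a\in\Sigma$ and $x,y\in\mathcal A$ selfadjoint. A smooth curve in $\Sigma$ joining $a$ and $b$ is a map $\gamma:[0,1]\to\Sigma$, differentiable for the norm of $\mathcal A$, with $\gamma(0)=a$ and $\gamma(1)=b$; its length is $\int_0^1\langle\dot\gamma(t),\dot\gamma(t)\rangle_{\gamma(t)}^{1/2}\,dt\in[0,\infty]$, and $dist(a,b)$ is the infimum of the lengths of all such curves. Let $a,b\in\Sigma$. Then $$\delta_{a,b}(t)=a^{1/2}\bigl(a^{-1/2}ba^{-1/2}\bigr)^t a^{1/2}$$ is the shortest smooth curve in $\Sigma$ joining $a$ and $b$. That is, $\delta_{a,b}$ is such a curve (even a $C^\infty$ one), no other such curve is shorter, and any such curve $\gamma$ of the same length is a reparametrization of it: $\gamma=\delta_{a,b}\circ f$ on $[0,1]$ with $f:[0,1]\to[0,1]$ continuous, nondecreasing, $f(0)=0$,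 $f(1)=1$. Moreover $$dist(a,b)=\bigl\|\ln\bigl(a^{-1/2}ba^{-1/2}\bigr)\bigr\|_2 .$$ -/

import Mathlib

open Set
open scoped ENNReal ContDiff ComplexOrder

noncomputable section

namespace TraceGeometry

universe u

variable {A : Type u} [CStarAlgebra A] [PartialOrder A] [StarOrderedRing A]

/-- A positive linear functional `τ` on `A` is a faithful normal tracial state. Normality is
expressed as preservation of suprema of increasing (upward directed) families of positive elements;
the order on `A` is the usual one (`0 ≤ x` iff `x` is positive). -/
structure IsFaithfulNormalTracialState (τ : A →ₚ[ℂ] ℂ) : Prop where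
  map_one : τ 1 = 1
  tracial : ∀ x y : A, τ (x * y) = τ (y * x)
  faithful : ∀ x : A, 0 ≤ x → τ x = 0 → x = 0
  normal : ∀ (D : Set A) (s : A), D.Nonempty → DirectedOn (· ≤ ·) D → (∀ d ∈ D, 0 ≤ d) →
    IsLUB D s → IsLUB ((fun d => (τ d).re) '' D) (τ s).re

/-- The norm `‖x‖₂ = τ(x* x)^{1/2}`. -/
def twoNorm (τ : A →ₚ[ℂ] ℂ) (x : A) : ℝ :=
  √(τ (star x * x)).re

variable (A) in
/-- The set `Σ` of positive invertible elements. -/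
def posInv : Set A := {a | 0 ≤ a ∧ IsUnit a}

/-- The metric `⟨x, y⟩_a = τ(x a⁻¹ y a⁻¹)` at `a ∈ Σ`, for selfadjoint `x`, `y`
(for these the trace on the right is a real number). -/
def metricAt (τ : A →ₚ[ℂ] ℂ) (a x y : A) : ℝ :=
  (τ (x * Ring.inverse a * y * Ring.inverse a)).re

/-- `γ`, restricted to `[0, 1]`, is a curve in `Σ` from `a` to `b` which is smooth in the sense of
being differentiable for the norm of `A` (one-sided derivatives at the end points). -/
structure IsSmoothCurve (γ : ℝ → A) (a b : A) : Prop where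
  mem : ∀ t ∈ Icc (0 : ℝ) 1, γ t ∈ posInv A
  differentiable : DifferentiableOn ℝ γ (Icc 0 1)
  source : γ 0 = a
  target : γ 1 = b

/-- The length `∫₀¹ ⟨γ', γ'⟩_γ^{1/2} dt` of a curve, with the value `∞` if the speed is not
integrable. -/
def length (τ : A →ₚ[ℂ] ℂ) (γ : ℝ → A) : ℝ≥0∞ :=
  ∫⁻ t in Icc (0 : ℝ) 1, ENNReal.ofReal
    √(metricAt τ (γ t) (derivWithin γ (Icc 0 1) t) (derivWithin γ (Icc 0 1) t))

/-- The distance: the infimum of the lengths of the smooth curves in `Σ` from `a` to `b`. -/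
def dist (τ : A →ₚ[ℂ] ℂ) (a b : A) : ℝ≥0∞ :=
  ⨅ (γ : ℝ → A) (_ : IsSmoothCurve γ a b), length τ γ

/-- The element `a^{-1/2} b a^{-1/2}`. -/
def conjInvSqrt (a b : A) : A :=
  a ^ (-(1 / 2) : ℝ) * b * a ^ (-(1 / 2) : ℝ)

/-- The curve `δ_{a,b}(t) = a^{1/2} (a^{-1/2} b a^{-1/2})^t a^{1/2}`. Powers are those of the
continuous functional calculus. -/
def geodesic (a b : A) (t : ℝ) : A :=
  a ^ (1 / 2 : ℝ) * (conjInvSqrt a b) ^ t * a ^ (1 / 2 : ℝ)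

end TraceGeometry

end

/-! Conjugation by an element of `Σ` preserves the metric, so conjugating by `a ^ (-1/2)` reduces
everything to curves starting at `1`, where the candidate is `t ↦ b ^ t = exp (t log b)`, of
constant speed `‖log b‖₂`.

For a smooth curve `γ` from `1`, the radial function `r = ‖log γ‖₂` grows no faster than arc length.
Indeed half the derivative of `r²` is `τ(log γ · D log(γ'))`. Since `log γ` commutes with `γ`, the
trace sees `D log(γ')` as `γ⁻¹ γ'`, hence as `γ^{-1/2} γ' γ^{-1/2}`, whose 2-norm is the speed.
Cauchy–Schwarz bounds this by `r` times the speed (`exists_log_variation`), and integration gives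
`‖log b‖₂ ≤ length γ`.

If the lengths agree, Cauchy–Schwarz is an equality almost everywhere where `r > 0`. Faithfulness
makes `γ^{-1/2} γ' γ^{-1/2}` a multiple of `log γ`, so `γ'` commutes with `γ` and `(log γ)'` is a
multiple of `log γ`. The direction `log γ / r` is then constant, `log γ` stays on the ray through
`log b`, and `γ` is a reparametrization of `b ^ t`.

Velocities are not assumed continuous, so the integrations use only everywhere differentiability and
integrable bounds. -/

noncomputable section

namespace TraceGeometry

/-! ### The logarithmic series in a Banach algebra and its derivative. -/

section LogSeries

open scoped RightActions

variable {𝔸 : Type*} [NormedRing 𝔸] [NormedAlgebra ℝ 𝔸]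

/-- The power series `∑ zⁿ⁺¹ / (n + 1)` of `-log (1 - z)` in a Banach algebra. -/
def logSeries (z : 𝔸) : 𝔸 := ∑' n : ℕ, ((n : ℝ) + 1)⁻¹ • z ^ (n + 1)

/-- The derivative at `z` of the term `zⁿ⁺¹ / (n + 1)` of the logarithmic series. -/
def logSeriesTermDeriv (z : 𝔸) (n : ℕ) : 𝔸 →L[ℝ] 𝔸 :=
  ((n : ℝ) + 1)⁻¹ • ∑ i ∈ Finset.range (n + 1), z ^ (n - i) •> ContinuousLinearMap.id ℝ 𝔸 <• z ^ i

lemma logSeriesTermDeriv_apply (z : 𝔸) (n : ℕ) (y : 𝔸) :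
    logSeriesTermDeriv z n y =
      ((n : ℝ) + 1)⁻¹ • ∑ i ∈ Finset.range (n + 1), z ^ (n - i) * y * z ^ i := by
  simp [logSeriesTermDeriv, mul_assoc]

lemma norm_logSeriesTermDeriv_le [NormOneClass 𝔸] (z : 𝔸) (n : ℕ) :
    ‖logSeriesTermDeriv z n‖ ≤ ‖z‖ ^ n := by
  refine ContinuousLinearMap.opNorm_le_bound _ (by positivity) fun y => ?_
  rw [logSeriesTermDeriv_apply, norm_smul, norm_inv, Real.norm_of_nonneg (by positivity)]
  have h : ‖∑ i ∈ Finset.range (n + 1), z ^ (n - i) * y * z ^ i‖ ≤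
      ∑ i ∈ Finset.range (n + 1), ‖z‖ ^ n * ‖y‖ := by
    refine norm_sum_le_of_le _ fun i hi => ?_
    have hi' : i ≤ n := by simpa [Nat.lt_succ_iff] using hi
    calc ‖z ^ (n - i) * y * z ^ i‖ ≤ ‖z‖ ^ (n - i) * ‖y‖ * ‖z‖ ^ i := by
          refine (norm_mul_le _ _).trans ?_
          gcongr
          · refine (norm_mul_le _ _).trans ?_
            gcongr
            exact norm_pow_le _ _
          · exact norm_pow_le _ _
      _ = ‖z‖ ^ n * ‖y‖ := by
          rw [mul_right_comm, ← pow_add, Nat.sub_add_cancel hi']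
  rw [Finset.sum_const, Finset.card_range, nsmul_eq_mul] at h
  rw [inv_mul_le_iff₀ (by positivity)]
  simpa using h

lemma summable_logSeriesTermDeriv [NormOneClass 𝔸] [CompleteSpace 𝔸] {z : 𝔸} (hz : ‖z‖ < 1) :
    Summable (logSeriesTermDeriv z) :=
  .of_norm_bounded (summable_geometric_of_lt_one (norm_nonneg z) hz)
    (norm_logSeriesTermDeriv_le z)

/-- On a ball of radius `ρ` strictly between `‖z‖` and `1` the derivatives of the terms are
dominated by `ρ ^ n`, which permits termwise differentiation. -/
lemma hasFDerivAt_logSeries [NormOneClass 𝔸] [CompleteSpace 𝔸] {z : 𝔸} (hz : ‖z‖ < 1) :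
    HasFDerivAt logSeries (∑' n, logSeriesTermDeriv z n) z := by
  obtain ⟨ρ, hzρ, hρ⟩ := exists_between hz
  have hρ0 : 0 ≤ ρ := (norm_nonneg z).trans hzρ.le
  refine hasFDerivAt_tsum_of_isPreconnected (u := fun n : ℕ => ρ ^ n)
    (s := Metric.ball (0 : 𝔸) ρ) (x₀ := 0) (f := fun n z => ((n : ℝ) + 1)⁻¹ • z ^ (n + 1))
    (f' := fun n z => logSeriesTermDeriv z n) (summable_geometric_of_lt_one hρ0 hρ) Metric.isOpen_ball
    (convex_ball _ _).isPreconnected (fun n x _ => ?_) (fun n x hx => ?_) ?_ ?_ ?_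
  · exact (hasFDerivAt_pow' (𝕜 := ℝ) (n + 1) (x := x)).fun_const_smul ((n : ℝ) + 1)⁻¹
  · refine (norm_logSeriesTermDeriv_le x n).trans ?_
    gcongr
    exact (mem_ball_zero_iff.1 hx).le
  · simpa using (norm_nonneg z).trans_lt hzρ
  · simp
  · simpa using hzρ

omit [NormedAlgebra ℝ 𝔸] in
lemma ringInverse_one_sub_eq_tsum [CompleteSpace 𝔸] {z : 𝔸} (hz : ‖z‖ < 1) :
    Ring.inverse (1 - z) = ∑' n : ℕ, z ^ n := by
  have hu : Ring.inverse (1 - z) * (1 - z) = 1 :=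
    Ring.inverse_mul_cancel _ (Units.oneSub z hz).isUnit
  calc Ring.inverse (1 - z) = Ring.inverse (1 - z) * ((1 - z) * ∑' n : ℕ, z ^ n) := by
        rw [mul_neg_geom_series z hz, mul_one]
    _ = ∑' n : ℕ, z ^ n := by rw [← mul_assoc, hu, one_mul]

lemma tsum_logSeriesTermDeriv_apply [NormOneClass 𝔸] [CompleteSpace 𝔸] {z : 𝔸} (hz : ‖z‖ < 1)
    (y : 𝔸) : (∑' n, logSeriesTermDeriv z n) y = ∑' n, logSeriesTermDeriv z n y :=
  (ContinuousLinearMap.apply ℝ 𝔸 y).map_tsum (summable_logSeriesTermDeriv hz)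

/-- The `n + 1` products `z ^ (n - i) * y * z ^ i` all equal `z ^ n * y`; their number cancels the
coefficient and a geometric series remains. -/
lemma logSeriesDeriv_of_commute [NormOneClass 𝔸] [CompleteSpace 𝔸] {z y : 𝔸} (hz : ‖z‖ < 1)
    (hy : Commute z y) :
    (∑' n, logSeriesTermDeriv z n) y = Ring.inverse (1 - z) * y := by
  have hg : Summable fun n : ℕ => z ^ n := summable_geometric_of_norm_lt_one hz
  rw [tsum_logSeriesTermDeriv_apply hz, ringInverse_one_sub_eq_tsum hz, ← hg.tsum_mul_right y]
  refine tsum_congr fun n => ?_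
  rw [logSeriesTermDeriv_apply, Finset.sum_congr rfl (g := fun _ => z ^ n * y), Finset.sum_const,
    Finset.card_range, ← Nat.cast_smul_eq_nsmul ℝ, smul_smul]
  · rw [Nat.cast_succ, inv_mul_cancel₀ (by positivity), one_smul]
  · intro i hi
    have hi' : i ≤ n := by simpa [Nat.lt_succ_iff] using hi
    rw [mul_assoc, ← (hy.pow_left i).eq, ← mul_assoc, ← pow_add, Nat.sub_add_cancel hi']

/-- Here `y` need not commute with `z`: cyclicity of `T`, together with `x` commuting with `z`,
merges the powers on both sides of `y`. -/
lemma tracial_logSeriesDeriv [NormOneClass 𝔸] [CompleteSpace 𝔸] (T : 𝔸 →L[ℝ] ℝ)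
    (hT : ∀ x y, T (x * y) = T (y * x)) {z x : 𝔸} (hz : ‖z‖ < 1) (hx : Commute x z) (y : 𝔸) :
    T (x * (∑' n, logSeriesTermDeriv z n) y) = T (x * Ring.inverse (1 - z) * y) := by
  have hs : Summable fun n => logSeriesTermDeriv z n y :=
    (summable_logSeriesTermDeriv hz).mapL (ContinuousLinearMap.apply ℝ 𝔸 y)
  have hg : Summable fun n : ℕ => z ^ n := summable_geometric_of_norm_lt_one hz
  have hgy : Summable fun n : ℕ => z ^ n * y := hg.mul_right y
  rw [tsum_logSeriesTermDeriv_apply hz, ringInverse_one_sub_eq_tsum hz, mul_assoc,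
    ← hg.tsum_mul_right y, ← hs.tsum_mul_left x, ← hgy.tsum_mul_left x,
    T.map_tsum (hs.mul_left x), T.map_tsum (hgy.mul_left x)]
  refine tsum_congr fun n => ?_
  rw [logSeriesTermDeriv_apply, mul_smul_comm, map_smul, Finset.mul_sum, map_sum,
    Finset.sum_congr rfl (g := fun _ => T (x * (z ^ n * y))), Finset.sum_const,
    Finset.card_range, ← Nat.cast_smul_eq_nsmul ℝ, smul_smul]
  · rw [Nat.cast_succ, inv_mul_cancel₀ (by positivity), one_smul]
  · intro i hi
    have hi' : i ≤ n := by simpa [Nat.lt_succ_iff] using hi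
    rw [← mul_assoc, hT, ← mul_assoc, ← mul_assoc, ← (hx.pow_right i).eq, mul_assoc x, ← pow_add,
      Nat.add_sub_cancel' hi', mul_assoc]

end LogSeries

/-! ### The trace inner product: Cauchy–Schwarz and its equality case. -/

section Trace

variable {A : Type*} [CStarAlgebra A] [PartialOrder A] [StarOrderedRing A]

/-- The real part of a positive linear functional, as a real continuous linear functional. -/
def reFunctional (τ : A →ₚ[ℂ] ℂ) : A →L[ℝ] ℝ :=
  Complex.reCLM.comp ((ContinuousLinearMap.mk τ.toLinearMap (map_continuous τ)).restrictScalars ℝ)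

lemma reFunctional_apply (τ : A →ₚ[ℂ] ℂ) (x : A) : reFunctional τ x = (τ x).re := rfl

variable {τ : A →ₚ[ℂ] ℂ}

lemma reFunctional_mul_comm (hτ : IsFaithfulNormalTracialState τ) (x y : A) :
    reFunctional τ (x * y) = reFunctional τ (y * x) := by
  simp only [reFunctional_apply, hτ.tracial x y]

lemma twoNorm_of_isSelfAdjoint {x : A} (hx : IsSelfAdjoint x) :
    twoNorm τ x = √(reFunctional τ (x * x)) := by
  rw [twoNorm, hx.star_eq, reFunctional_apply]

lemma reFunctional_mul_self_nonneg {x : A} (hx : IsSelfAdjoint x) :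
    0 ≤ reFunctional τ (x * x) :=
  (Complex.nonneg_iff.1 (map_nonneg τ hx.mul_self_nonneg)).1

omit [StarOrderedRing A] in
lemma twoNorm_nonneg (x : A) : 0 ≤ twoNorm τ x := Real.sqrt_nonneg _

lemma twoNorm_sq {x : A} (hx : IsSelfAdjoint x) :
    twoNorm τ x ^ 2 = reFunctional τ (x * x) := by
  rw [twoNorm_of_isSelfAdjoint hx, Real.sq_sqrt (reFunctional_mul_self_nonneg hx)]

lemma eq_zero_of_reFunctional_mul_self (hτ : IsFaithfulNormalTracialState τ) {x : A}
    (hx : IsSelfAdjoint x) (h : reFunctional τ (x * x) = 0) : x = 0 := by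
  have hpos : 0 ≤ x * x := hx.mul_self_nonneg
  have h0 : τ (x * x) = 0 :=
    Complex.ext h (Complex.nonneg_iff.1 (map_nonneg τ hpos)).2.symm
  have := hτ.faithful _ hpos h0
  rw [← CStarRing.star_mul_self_eq_zero_iff, hx.star_eq, this]

lemma reFunctional_sub_smul (hτ : IsFaithfulNormalTracialState τ) (x y : A) (p q : ℝ) :
    reFunctional τ ((p • x - q • y) * (p • x - q • y)) = p ^ 2 * reFunctional τ (x * x)
      - 2 * p * q * reFunctional τ (x * y) + q ^ 2 * reFunctional τ (y * y) := by
  simp only [mul_sub, sub_mul, smul_mul_smul_comm, map_sub, map_smul, smul_eq_mul,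
    reFunctional_mul_comm hτ y x]
  ring

/-- Expand the nonnegative trace of the square of `‖y‖₂ x - ‖x‖₂ y` and divide by `‖x‖₂ ‖y‖₂`. If a
norm vanishes, faithfulness makes the element zero. -/
lemma reFunctional_mul_le (hτ : IsFaithfulNormalTracialState τ) {x y : A}
    (hx : IsSelfAdjoint x) (hy : IsSelfAdjoint y) :
    reFunctional τ (x * y) ≤ twoNorm τ x * twoNorm τ y := by
  by_contra! h
  have hX := twoNorm_sq (τ := τ) hx
  have hY := twoNorm_sq (τ := τ) hy
  have h1 := twoNorm_nonneg (τ := τ) x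
  have h2 := twoNorm_nonneg (τ := τ) y
  rcases h2.eq_or_lt with h2 | h2
  · have hy0 : y = 0 := eq_zero_of_reFunctional_mul_self hτ hy (by rw [← hY, ← h2]; simp)
    simp [hy0, twoNorm] at h
  rcases h1.eq_or_lt with h1 | h1
  · have hx0 : x = 0 := eq_zero_of_reFunctional_mul_self hτ hx (by rw [← hX, ← h1]; simp)
    simp [hx0, twoNorm] at h
  have := reFunctional_mul_self_nonneg (τ := τ)
    (((IsSelfAdjoint.all (twoNorm τ y)).smul hx).sub ((IsSelfAdjoint.all (twoNorm τ x)).smul hy))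
  rw [reFunctional_sub_smul hτ, ← hX, ← hY] at this
  nlinarith [mul_pos h1 h2]

lemma abs_reFunctional_mul_le (hτ : IsFaithfulNormalTracialState τ) {x y : A}
    (hx : IsSelfAdjoint x) (hy : IsSelfAdjoint y) :
    |reFunctional τ (x * y)| ≤ twoNorm τ x * twoNorm τ y := by
  rw [abs_le']
  refine ⟨reFunctional_mul_le hτ hx hy, ?_⟩
  have := reFunctional_mul_le hτ hx.neg hy
  simpa [twoNorm] using this

/-- Under equality the square used for Cauchy–Schwarz has trace zero, so by faithfulness its base is
zero. -/
lemma eq_smul_of_reFunctional_mul_eq (hτ : IsFaithfulNormalTracialState τ) {x y : A}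
    (hx : IsSelfAdjoint x) (hy : IsSelfAdjoint y) (hx0 : twoNorm τ x ≠ 0)
    (h : reFunctional τ (x * y) = twoNorm τ x * twoNorm τ y) :
    y = (twoNorm τ y / twoNorm τ x) • x := by
  have h0 : twoNorm τ y • x - twoNorm τ x • y = 0 := by
    refine eq_zero_of_reFunctional_mul_self hτ
      (((IsSelfAdjoint.all _).smul hx).sub ((IsSelfAdjoint.all _).smul hy)) ?_
    rw [reFunctional_sub_smul hτ, ← twoNorm_sq hx, ← twoNorm_sq hy, h]
    ring
  rw [div_eq_inv_mul, mul_smul, sub_eq_zero.1 h0, inv_smul_smul₀ hx0]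

end Trace

/-! ### Differentiability of the logarithm on `Σ`. -/

section Log

open Filter Topology

variable {A : Type*} [CStarAlgebra A]

/-- The scalar series converges uniformly on the spectrum of `z`, and the functional calculus is
continuous under uniform convergence. -/
lemma log_one_sub_eq [Nontrivial A] {z : A} (hz : IsSelfAdjoint z) (hz1 : ‖z‖ < 1) :
    CFC.log (1 - z) = -logSeries z := by
  have hspec : ∀ x ∈ spectrum ℝ z, |x| ≤ ‖z‖ := fun x hx => spectrum.norm_le_norm_of_mem hx
  have h1 : CFC.log (1 - z) = cfc (fun x : ℝ => Real.log (1 - x)) z := by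
    have h : (1 : A) - z = cfc (fun x : ℝ => 1 - x) z := by
      rw [cfc_sub .., cfc_const_one .., cfc_id' ..]
    rw [CFC.log, h, ← cfc_comp' Real.log (fun x : ℝ => 1 - x) z ?_]
    refine Real.continuousOn_log.mono ?_
    rintro _ ⟨x, hx, rfl⟩
    have := (abs_le.1 (hspec x hx)).2
    simp only [mem_compl_iff, mem_singleton_iff]
    linarith
  have hunif : TendstoUniformlyOn
      (fun (N : ℕ) (x : ℝ) => ∑ n ∈ Finset.range N, ((n : ℝ) + 1)⁻¹ • x ^ (n + 1))
      (fun x => -Real.log (1 - x)) atTop (spectrum ℝ z) := by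
    have := tendstoUniformlyOn_tsum_nat (f := fun (n : ℕ) (x : ℝ) => ((n : ℝ) + 1)⁻¹ • x ^ (n + 1))
      (u := fun n => ‖z‖ ^ n) (s := spectrum ℝ z)
      (summable_geometric_of_lt_one (norm_nonneg z) hz1) ?_
    · refine this.congr_right fun x hx => ?_
      have hx1 : |x| < 1 := (hspec x hx).trans_lt hz1
      rw [← (Real.hasSum_pow_div_log_of_abs_lt_one hx1).tsum_eq]
      simp only [smul_eq_mul, div_eq_inv_mul]
    · intro n x hx
      rw [norm_smul, norm_inv, Real.norm_of_nonneg (by positivity), norm_pow, Real.norm_eq_abs]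
      calc ((n : ℝ) + 1)⁻¹ * |x| ^ (n + 1) ≤ 1 * ‖z‖ ^ (n + 1) := by
            gcongr
            · exact inv_le_one_of_one_le₀ (by linarith [n.cast_nonneg (α := ℝ)])
            · exact hspec x hx
        _ ≤ ‖z‖ ^ n := by
            rw [one_mul]
            exact pow_le_pow_of_le_one (norm_nonneg z) hz1.le n.le_succ
  have hlim := tendsto_cfc_fun (a := z) hunif (Eventually.of_forall fun N => by fun_prop)
  have hsum : Summable fun n : ℕ => ((n : ℝ) + 1)⁻¹ • z ^ (n + 1) := by
    refine .of_norm_bounded (summable_geometric_of_lt_one (norm_nonneg z) hz1) fun n => ?_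
    rw [norm_smul, norm_inv, Real.norm_of_nonneg (by positivity)]
    calc ((n : ℝ) + 1)⁻¹ * ‖z ^ (n + 1)‖ ≤ 1 * ‖z‖ ^ (n + 1) := by
          gcongr
          · exact inv_le_one_of_one_le₀ (by linarith [n.cast_nonneg (α := ℝ)])
          · exact norm_pow_le _ _
      _ ≤ ‖z‖ ^ n := by
          rw [one_mul]
          exact pow_le_pow_of_le_one (norm_nonneg z) hz1.le n.le_succ
  have hpoly : ∀ N : ℕ,
      cfc (fun x : ℝ => ∑ n ∈ Finset.range N, ((n : ℝ) + 1)⁻¹ • x ^ (n + 1)) z =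
        ∑ n ∈ Finset.range N, ((n : ℝ) + 1)⁻¹ • z ^ (n + 1) := fun N => by
    have hfun : (fun x : ℝ => ∑ n ∈ Finset.range N, ((n : ℝ) + 1)⁻¹ • x ^ (n + 1)) =
        ∑ n ∈ Finset.range N, fun x : ℝ => ((n : ℝ) + 1)⁻¹ • x ^ (n + 1) := by
      ext x
      simp
    rw [hfun, cfc_sum _ _ _ (fun n _ => by fun_prop)]
    refine Finset.sum_congr rfl fun n _ => ?_
    rw [cfc_smul _ _ _ (by fun_prop), cfc_pow_id z (n + 1)]
  simp only [hpoly] at hlim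
  rw [h1, logSeries, ← tendsto_nhds_unique hlim hsum.hasSum.tendsto_sum_nat, cfc_neg, neg_neg]

variable [PartialOrder A] [StarOrderedRing A]

omit [StarOrderedRing A] in
lemma isStrictlyPositive_of_mem_posInv {c : A} (hc : c ∈ posInv A) : IsStrictlyPositive c :=
  ⟨hc.1, hc.2⟩

/-- Rescaling by `K` only adds the scalar `log K`, so the series, valid near `1`, describes the
logarithm near any point of `Σ`. -/
lemma log_eq_sub_logSeries [Nontrivial A] {c : A} (hc : c ∈ posInv A) {K : ℝ} (hK : 0 < K)
    (h : ‖1 - K⁻¹ • c‖ < 1) :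
    CFC.log c = algebraMap ℝ A (Real.log K) - logSeries (1 - K⁻¹ • c) := by
  have hz : IsSelfAdjoint (1 - K⁻¹ • c) :=
    (IsSelfAdjoint.one A).sub ((IsSelfAdjoint.all K⁻¹).smul hc.1.isSelfAdjoint)
  have hlog := log_one_sub_eq hz h
  have hc' : c = K • (K⁻¹ • c) := (smul_inv_smul₀ hK.ne' c).symm
  rw [sub_sub_cancel] at hlog
  have hs : IsStrictlyPositive (K⁻¹ • c) :=
    (isStrictlyPositive_of_mem_posInv hc).smul (inv_pos.2 hK)
  conv_lhs => rw [hc', CFC.log_smul' _ hK hs, hlog]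
  abel

lemma exists_norm_one_sub_inv_smul_lt [Nontrivial A] {c : A} (hc : c ∈ posInv A) :
    ∃ K : ℝ, 0 < K ∧ ‖1 - K⁻¹ • c‖ < 1 := by
  have hK : 0 < ‖c‖ := norm_pos_iff.2 hc.2.ne_zero
  refine ⟨‖c‖, hK, ?_⟩
  have h1 : 0 ≤ 1 - ‖c‖⁻¹ • c := by
    have : ‖c‖⁻¹ • c ≤ ‖c‖⁻¹ • algebraMap ℝ A ‖c‖ := by
      gcongr
      exact IsSelfAdjoint.le_algebraMap_norm_self hc.1.isSelfAdjoint
    rw [Algebra.algebraMap_eq_smul_one, inv_smul_smul₀ hK.ne'] at this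
    exact sub_nonneg.2 this
  have h2 : 1 - ‖c‖⁻¹ • c ≤ 1 := sub_le_self _ (smul_nonneg (by positivity) hc.1)
  -- Norm exactly `1` would put `1` in the spectrum of this positive element, contradicting
  -- invertibility of `c`.
  refine lt_of_le_of_ne ((CStarAlgebra.norm_le_one_iff_of_nonneg _ h1).2 h2) fun h => ?_
  have hmem := CStarAlgebra.norm_mem_spectrum_of_nonneg h1
  rw [h, spectrum.mem_iff, map_one, sub_sub_cancel] at hmem
  exact hmem (hc.2.smul (Units.mk0 ‖c‖⁻¹ (inv_ne_zero hK.ne')))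

/-- The derivative of the logarithm at `c`, acting on elements which commute with `c` and under
a tracial functional. -/
lemma exists_hasFDerivWithinAt_log [Nontrivial A] (T : A →L[ℝ] ℝ)
    (hT : ∀ x y, T (x * y) = T (y * x)) {c : A} (hc : c ∈ posInv A) :
    ∃ D : A →L[ℝ] A, HasFDerivWithinAt CFC.log D (posInv A) c ∧
      (∀ y, Commute c y → D y = Ring.inverse c * y) ∧
      ∀ x y, Commute x c → T (x * D y) = T (x * Ring.inverse c * y) := by
  obtain ⟨K, hK, hcK⟩ := exists_norm_one_sub_inv_smul_lt hc
  have hinv : Ring.inverse (1 - (1 - K⁻¹ • c)) = K • Ring.inverse c := by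
    have hu : K⁻¹ • c * (K • Ring.inverse c) = 1 := by
      rw [smul_mul_smul_comm, Ring.mul_inverse_cancel c hc.2, inv_mul_cancel₀ hK.ne', one_smul]
    have hu' : Ring.inverse (K⁻¹ • c) * (K⁻¹ • c) = 1 :=
      Ring.inverse_mul_cancel _ (hc.2.smul (Units.mk0 K⁻¹ (inv_ne_zero hK.ne')))
    rw [sub_sub_cancel]
    exact left_inv_eq_right_inv hu' hu
  let D := ∑' n, logSeriesTermDeriv (1 - K⁻¹ • c) n
  have haff : HasFDerivAt (fun x : A => 1 - K⁻¹ • x) (-(K⁻¹ • ContinuousLinearMap.id ℝ A)) c := by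
    simpa using ((hasFDerivAt_id (𝕜 := ℝ) c).fun_const_smul K⁻¹).const_sub (1 : A)
  have hcomp := ((hasFDerivAt_logSeries hcK).comp c haff).const_sub (algebraMap ℝ A (Real.log K))
  have hD : ∀ y, (-(D.comp (-(K⁻¹ • ContinuousLinearMap.id ℝ A)))) y = K⁻¹ • D y := fun y => by
    simp
  refine ⟨-(D.comp (-(K⁻¹ • ContinuousLinearMap.id ℝ A))), ?_, fun y hy => ?_, fun x y hx => ?_⟩
  · refine hcomp.hasFDerivWithinAt.congr_of_eventuallyEq ?_ (log_eq_sub_logSeries hc hK hcK)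
    have hnear : ∀ᶠ x in 𝓝 c, ‖1 - K⁻¹ • x‖ < 1 :=
      (haff.continuousAt.norm).eventually_lt continuousAt_const hcK
    filter_upwards [self_mem_nhdsWithin, hnear.filter_mono nhdsWithin_le_nhds] with x hx hx1
    exact log_eq_sub_logSeries hx hK hx1
  · have hcomm : Commute (1 - K⁻¹ • c) y :=
      (Commute.one_left y).sub_left (hy.smul_left _)
    rw [hD, logSeriesDeriv_of_commute hcK hcomm, hinv, smul_mul_assoc, inv_smul_smul₀ hK.ne']
  · have hcomm : Commute x (1 - K⁻¹ • c) :=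
      (Commute.one_right x).sub_right (hx.smul_right _)
    rw [hD, mul_smul_comm, map_smul, tracial_logSeriesDeriv T hT hcK hcomm, hinv, mul_smul_comm,
      smul_mul_assoc, map_smul, inv_smul_smul₀ hK.ne']

end Log

/-! ### Integration of derivatives that need not be continuous. -/

section Calculus

open MeasureTheory Filter Topology intervalIntegral

/-- Since `√q` may fail to be differentiable where `q` vanishes, `q` is replaced by `q + ε²`; the
derivative of its root is still at most `v`, and the error is at most `ε`. -/
lemma sqrt_sub_sqrt_le_integral {q q' v : ℝ → ℝ} {s t : ℝ} (hst : s ≤ t)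
    (hq : ∀ u ∈ Icc s t, 0 ≤ q u) (hcont : ContinuousOn q (Icc s t))
    (hderiv : ∀ u ∈ Ioo s t, HasDerivAt q (q' u) u) (hv : IntegrableOn v (Icc s t))
    (hv0 : ∀ u, 0 ≤ v u) (hbound : ∀ u ∈ Ioo s t, q' u ≤ 2 * (√(q u) * v u)) :
    √(q t) - √(q s) ≤ ∫ u in s..t, v u := by
  refine le_of_forall_pos_le_add fun ε hε => ?_
  have hpos : ∀ u ∈ Icc s t, 0 < q u + ε ^ 2 := fun u hu => by
    have := hq u hu
    positivity
  have key : √(q t + ε ^ 2) - √(q s + ε ^ 2) ≤ ∫ u in s..t, v u := by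
    refine sub_le_integral_of_hasDeriv_right_of_le (g := fun u => √(q u + ε ^ 2))
      (g' := fun u => q' u / (2 * √(q u + ε ^ 2))) hst
      ((hcont.add continuousOn_const).sqrt) (fun u hu => ?_) hv fun u hu => ?_
    · exact (((hderiv u hu).add_const _).sqrt (hpos u (Ioo_subset_Icc_self hu)).ne').hasDerivWithinAt
    · have h1 := Real.sqrt_pos.2 (hpos u (Ioo_subset_Icc_self hu))
      have h2 : √(q u) ≤ √(q u + ε ^ 2) := Real.sqrt_le_sqrt (by nlinarith)
      rw [div_le_iff₀ (by positivity)]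
      nlinarith [hbound u hu, hv0 u, mul_le_mul_of_nonneg_right h2 (hv0 u)]
  have h1 : √(q t) ≤ √(q t + ε ^ 2) := Real.sqrt_le_sqrt (by nlinarith)
  have h2 : √(q s + ε ^ 2) ≤ √(q s) + ε := by
    refine Real.sqrt_le_iff.2 ⟨by positivity, ?_⟩
    nlinarith [Real.sq_sqrt (hq s (left_mem_Icc.2 hst)), Real.sqrt_nonneg (q s)]
  linarith

/-- Domination by `v` makes `r'` integrable, so the fundamental theorem applies; then `v - r'` is
nonnegative with integral zero. -/
lemma ae_eq_of_sub_eq_integral {r r' v : ℝ → ℝ} {s t : ℝ} (hst : s ≤ t)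
    (hcont : ContinuousOn r (Icc s t)) (hderiv : ∀ u ∈ Ioo s t, HasDerivAt r (r' u) u)
    (hv : IntegrableOn v (Icc s t)) (hbound : ∀ u ∈ Ioo s t, |r' u| ≤ v u)
    (heq : r t - r s = ∫ u in s..t, v u) :
    ∀ᵐ u ∂volume.restrict (Ioo s t), r' u = v u := by
  have hvo : IntegrableOn v (Ioo s t) := hv.mono_set Ioo_subset_Icc_self
  have hr' : IntegrableOn r' (Ioo s t) := by
    refine Integrable.mono' hvo ?_ ((ae_restrict_iff' measurableSet_Ioo).2 (ae_of_all _ hbound))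
    refine (stronglyMeasurable_deriv r).aestronglyMeasurable.congr ?_
    exact (ae_restrict_iff' measurableSet_Ioo).2 (ae_of_all _ fun u hu => (hderiv u hu).deriv)
  have hint : IntervalIntegrable r' volume s t := by
    rwa [intervalIntegrable_iff_integrableOn_Ioo_of_le hst]
  have hFTC := integral_eq_sub_of_hasDerivAt_of_le hst hcont hderiv hint
  rw [heq, integral_of_le hst, integral_of_le hst, integral_Ioc_eq_integral_Ioo,
    integral_Ioc_eq_integral_Ioo] at hFTC
  have h0 : ∫ u in Ioo s t, (v u - r' u) = 0 := by
    rw [integral_sub hvo hr', hFTC, sub_self]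
  have hnonneg : 0 ≤ᵐ[volume.restrict (Ioo s t)] fun u => v u - r' u :=
    (ae_restrict_iff' measurableSet_Ioo).2
      (ae_of_all _ fun u hu => sub_nonneg.2 ((le_abs_self _).trans (hbound u hu)))
  filter_upwards [(integral_eq_zero_iff_of_nonneg_ae hnonneg (hvo.sub hr')).1 h0] with u hu
  exact (sub_eq_zero.1 hu).symm

/-- Vanishing almost everywhere suffices because the derivative exists at every interior point,
which excludes Cantor-type functions. -/
lemma eq_of_hasDerivAt_of_ae_eq_zero {E : Type*} [NormedAddCommGroup E] [NormedSpace ℝ E]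
    [CompleteSpace E] {f f' : ℝ → E} {s t : ℝ} (hst : s ≤ t) (hcont : ContinuousOn f (Icc s t))
    (hderiv : ∀ u ∈ Ioo s t, HasDerivAt f (f' u) u)
    (hzero : ∀ᵐ u ∂volume.restrict (Ioo s t), f' u = 0) : f t = f s := by
  have hz : f' =ᵐ[volume.restrict (Ioo s t)] fun _ => (0 : E) := hzero
  have hint : IntervalIntegrable f' volume s t := by
    rw [intervalIntegrable_iff_integrableOn_Ioo_of_le hst]
    exact (integrable_zero _ _ _).congr hz.symm
  have hFTC := integral_eq_sub_of_hasDerivAt_of_le hst hcont hderiv hint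
  rw [integral_of_le hst, integral_Ioc_eq_integral_Ioo, integral_congr_ae hz,
    integral_zero] at hFTC
  exact (sub_eq_zero.1 hFTC.symm)

end Calculus

/-! ### Speed, length and the first variation of the logarithm. -/

section Curves

open MeasureTheory Filter Topology

variable {A : Type*} [CStarAlgebra A] [PartialOrder A] [StarOrderedRing A] {τ : A →ₚ[ℂ] ℂ}

/-- The speed of a curve with respect to the trace metric. -/
def speed (τ : A →ₚ[ℂ] ℂ) (γ : ℝ → A) (t : ℝ) : ℝ :=
  √(metricAt τ (γ t) (derivWithin γ (Icc 0 1) t) (derivWithin γ (Icc 0 1) t))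

omit [StarOrderedRing A] in
lemma length_eq_lintegral_speed (γ : ℝ → A) :
    length τ γ = ∫⁻ t in Icc (0 : ℝ) 1, ENNReal.ofReal (speed τ γ t) := rfl

omit [StarOrderedRing A] in
lemma speed_nonneg (γ : ℝ → A) (t : ℝ) : 0 ≤ speed τ γ t := Real.sqrt_nonneg _

lemma metricAt_eq (c x y : A) :
    metricAt τ c x y = reFunctional τ (x * Ring.inverse c * y * Ring.inverse c) := rfl

lemma invSqrt_mul_invSqrt {c : A} (hc : c ∈ posInv A) :
    c ^ (-(1 / 2) : ℝ) * c ^ (-(1 / 2) : ℝ) = Ring.inverse c := by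
  rw [← CFC.rpow_add hc.2, CFC.inverse_eq_rpow_neg_one (isStrictlyPositive_of_mem_posInv hc)]
  norm_num

lemma isSelfAdjoint_rpow (c : A) (s : ℝ) : IsSelfAdjoint (c ^ s) :=
  CFC.rpow_nonneg.isSelfAdjoint

lemma isSelfAdjoint_rpow_mul_mul_rpow (c : A) (s : ℝ) {y : A} (hy : IsSelfAdjoint y) :
    IsSelfAdjoint (c ^ s * y * c ^ s) := by
  have h := hy.conjugate (c ^ s)
  rwa [(isSelfAdjoint_rpow c s).star_eq] at h

lemma sqrt_metricAt_self (hτ : IsFaithfulNormalTracialState τ) {c y : A} (hc : c ∈ posInv A)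
    (hy : IsSelfAdjoint y) :
    √(metricAt τ c y y) = twoNorm τ (c ^ (-(1 / 2) : ℝ) * y * c ^ (-(1 / 2) : ℝ)) := by
  rw [twoNorm_of_isSelfAdjoint (isSelfAdjoint_rpow_mul_mul_rpow c _ hy), metricAt_eq,
    ← invSqrt_mul_invSqrt hc]
  simp only [mul_assoc]
  rw [reFunctional_mul_comm hτ (c ^ (-(1 / 2) : ℝ))]
  simp only [mul_assoc]

lemma reFunctional_mul_inverse_mul (hτ : IsFaithfulNormalTracialState τ) {c x : A}
    (hc : c ∈ posInv A) (hx : Commute x (c ^ (-(1 / 2) : ℝ))) (y : A) :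
    reFunctional τ (x * Ring.inverse c * y) =
      reFunctional τ (x * (c ^ (-(1 / 2) : ℝ) * y * c ^ (-(1 / 2) : ℝ))) := by
  rw [← invSqrt_mul_invSqrt hc, ← mul_assoc, hx.eq, mul_assoc, mul_assoc,
    reFunctional_mul_comm hτ]
  simp only [mul_assoc]

lemma commute_log_rpow {c : A} (hc : 0 ≤ c) (s : ℝ) : Commute (CFC.log c) (c ^ s) := by
  rw [CFC.rpow_eq_cfc_real hc]
  exact cfc_commute_cfc _ _ c

lemma commute_log_self {c : A} (hc : 0 ≤ c) : Commute (CFC.log c) c := by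
  simpa only [CFC.rpow_one c hc] using commute_log_rpow hc 1

lemma rpow_mem_posInv {c : A} (hc : c ∈ posInv A) (s : ℝ) : c ^ s ∈ posInv A :=
  ⟨CFC.rpow_nonneg, hc.2.cfcRpow s hc.1⟩

/-- First variation of the logarithm along a curve with velocity `y` at `c`. -/
lemma exists_log_variation (hτ : IsFaithfulNormalTracialState τ) {c : A} (hc : c ∈ posInv A) :
    ∃ D : A →L[ℝ] A, HasFDerivWithinAt CFC.log D (posInv A) c ∧ ∀ y, IsSelfAdjoint y →
      |reFunctional τ (CFC.log c * D y)| ≤ twoNorm τ (CFC.log c) * √(metricAt τ c y y) ∧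
      (twoNorm τ (CFC.log c) ≠ 0 →
        reFunctional τ (CFC.log c * D y) = twoNorm τ (CFC.log c) * √(metricAt τ c y y) →
        D y = (√(metricAt τ c y y) / twoNorm τ (CFC.log c)) • CFC.log c) := by
  have : Nontrivial A := by
    refine ⟨1, 0, fun h => ?_⟩
    have h1 := hτ.map_one
    rw [h, map_zero] at h1
    exact zero_ne_one h1
  obtain ⟨D, hD, hcomm, htr⟩ :=
    exists_hasFDerivWithinAt_log (reFunctional τ) (reFunctional_mul_comm hτ) hc
  refine ⟨D, hD, fun y hy => ?_⟩
  set w := c ^ (-(1 / 2) : ℝ) with hw_def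
  have hwy : IsSelfAdjoint (w * y * w) := isSelfAdjoint_rpow_mul_mul_rpow c _ hy
  have hlog : IsSelfAdjoint (CFC.log c) := IsSelfAdjoint.log
  have heq : reFunctional τ (CFC.log c * D y) = reFunctional τ (CFC.log c * (w * y * w)) := by
    rw [htr _ _ (commute_log_self hc.1),
      reFunctional_mul_inverse_mul hτ hc (commute_log_rpow hc.1 _)]
  rw [heq, sqrt_metricAt_self hτ hc hy]
  refine ⟨abs_reFunctional_mul_le hτ hlog hwy, fun h0 h => ?_⟩
  have hprop := eq_smul_of_reFunctional_mul_eq hτ hlog hwy h0 h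
  set l := twoNorm τ (w * y * w) / twoNorm τ (CFC.log c)
  let k := c ^ (1 / 2 : ℝ)
  have hs := isStrictlyPositive_of_mem_posInv hc
  have hkw : k * w = 1 := CFC.rpow_mul_rpow_neg _ hs
  have hwk : w * k = 1 := CFC.rpow_neg_mul_rpow _ hs
  have hkk : k * k = c := by
    rw [← CFC.rpow_add hc.2]
    norm_num
    exact CFC.rpow_one c hc.1
  -- Undoing the conjugation in the equality case shows that `y` commutes with `c`; only then is `D
  -- y` itself, and not just its trace against `log c`, equal to `c⁻¹ y`.
  have hy' : y = l • (c * CFC.log c) := by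
    calc y = (k * w) * y * (w * k) := by rw [hkw, hwk, one_mul, mul_one]
      _ = k * (w * y * w) * k := by simp only [mul_assoc]
      _ = l • (c * CFC.log c) := by
        rw [hprop, mul_smul_comm, smul_mul_assoc, mul_assoc,
          (commute_log_rpow hc.1 (1 / 2)).eq, ← mul_assoc, hkk]
  have hcy : Commute c y := by
    rw [hy']
    exact ((Commute.refl c).mul_right (commute_log_self hc.1).symm).smul_right l
  rw [hcomm y hcy]
  conv_lhs => rw [hy']
  rw [mul_smul_comm, ← mul_assoc, Ring.inverse_mul_cancel _ hc.2, one_mul]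

omit [StarOrderedRing A] in
lemma IsSmoothCurve.hasDerivWithinAt {γ : ℝ → A} {a b : A} (hγ : IsSmoothCurve γ a b) {t : ℝ}
    (ht : t ∈ Icc (0 : ℝ) 1) :
    HasDerivWithinAt γ (derivWithin γ (Icc 0 1) t) (Icc 0 1) t :=
  (hγ.differentiable t ht).hasDerivWithinAt

lemma IsSmoothCurve.isSelfAdjoint_derivWithin {γ : ℝ → A} {a b : A} (hγ : IsSmoothCurve γ a b)
    {t : ℝ} (ht : t ∈ Icc (0 : ℝ) 1) : IsSelfAdjoint (derivWithin γ (Icc 0 1) t) := by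
  have h := hγ.hasDerivWithinAt ht
  have hstar := h.star.congr (f₁ := γ) (fun s hs => ((hγ.mem s hs).1.isSelfAdjoint.star_eq).symm)
    (hγ.mem t ht).1.isSelfAdjoint.star_eq.symm
  exact (uniqueDiffOn_Icc_zero_one t ht).eq_deriv _ hstar h

/-- The logarithm of a smooth curve is differentiable, and its derivative is controlled by the
speed. -/
lemma IsSmoothCurve.exists_log_deriv (hτ : IsFaithfulNormalTracialState τ) {γ : ℝ → A} {a b : A}
    (hγ : IsSmoothCurve γ a b) {t : ℝ} (ht : t ∈ Icc (0 : ℝ) 1) :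
    ∃ x' : A, HasDerivWithinAt (fun s => CFC.log (γ s)) x' (Icc 0 1) t ∧
      |reFunctional τ (CFC.log (γ t) * x')| ≤ twoNorm τ (CFC.log (γ t)) * speed τ γ t ∧
      (twoNorm τ (CFC.log (γ t)) ≠ 0 →
        reFunctional τ (CFC.log (γ t) * x') = twoNorm τ (CFC.log (γ t)) * speed τ γ t →
        x' = (speed τ γ t / twoNorm τ (CFC.log (γ t))) • CFC.log (γ t)) := by
  obtain ⟨D, hD, hDy⟩ := exists_log_variation hτ (hγ.mem t ht)
  exact ⟨_, hD.comp_hasDerivWithinAt t (hγ.hasDerivWithinAt ht) hγ.mem,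
    hDy _ (hγ.isSelfAdjoint_derivWithin ht)⟩

omit [StarOrderedRing A] in
lemma IsSmoothCurve.continuousOn {γ : ℝ → A} {a b : A} (hγ : IsSmoothCurve γ a b) :
    ContinuousOn γ (Icc 0 1) := hγ.differentiable.continuousOn

/-- The velocity may be discontinuous, but a derivative is always measurable; the one-sided end
points form a null set. -/
lemma IsSmoothCurve.aestronglyMeasurable_speed {γ : ℝ → A} {a b : A} (hγ : IsSmoothCurve γ a b) :
    AEStronglyMeasurable (speed τ γ) (volume.restrict (Icc 0 1)) := by
  have hinv : AEStronglyMeasurable (fun t => Ring.inverse (γ t)) (volume.restrict (Icc 0 1)) := by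
    refine ContinuousOn.aestronglyMeasurable (fun t ht => ?_) measurableSet_Icc
    obtain ⟨u, hu⟩ := (hγ.mem t ht).2
    have := NormedRing.inverse_continuousAt u
    rw [hu] at this
    exact this.comp_continuousWithinAt (hγ.continuousOn t ht)
  have hder : AEStronglyMeasurable (derivWithin γ (Icc 0 1)) (volume.restrict (Icc 0 1)) := by
    refine (stronglyMeasurable_deriv γ).aestronglyMeasurable.congr ?_
    rw [← restrict_Ioo_eq_restrict_Icc]
    exact (ae_restrict_iff' measurableSet_Ioo).2
      (ae_of_all _ fun t ht => (derivWithin_of_mem_nhds (Icc_mem_nhds ht.1 ht.2)).symm)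
  exact Real.continuous_sqrt.comp_aestronglyMeasurable
    ((reFunctional τ).continuous.comp_aestronglyMeasurable (((hder.mul hinv).mul hder).mul hinv))

lemma IsSmoothCurve.integrableOn_speed {γ : ℝ → A} {a b : A} (hγ : IsSmoothCurve γ a b)
    (h : length τ γ ≠ ⊤) : IntegrableOn (speed τ γ) (Icc 0 1) := by
  refine ⟨hγ.aestronglyMeasurable_speed, ?_⟩
  rw [hasFiniteIntegral_iff_ofReal (ae_of_all _ (speed_nonneg γ))]
  exact lt_top_iff_ne_top.2 h

lemma IsSmoothCurve.length_eq_ofReal {γ : ℝ → A} {a b : A} (hγ : IsSmoothCurve γ a b)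
    (h : length τ γ ≠ ⊤) : length τ γ = ENNReal.ofReal (∫ t in (0 : ℝ)..1, speed τ γ t) := by
  rw [intervalIntegral.integral_of_le zero_le_one, ← integral_Icc_eq_integral_Ioc,
    ofReal_integral_eq_lintegral_ofReal (hγ.integrableOn_speed h)
      (ae_of_all _ (speed_nonneg γ)), length_eq_lintegral_speed]

end Curves

/-! ### Minimality and rigidity for curves starting at `1`. -/

section Minimality

open MeasureTheory Filter Topology

variable {A : Type*} [CStarAlgebra A] [PartialOrder A] [StarOrderedRing A] {τ : A →ₚ[ℂ] ℂ}

lemma hasDerivAt_reFunctional_mul_self (hτ : IsFaithfulNormalTracialState τ) {x : ℝ → A} {x' : A}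
    {t : ℝ} (hx : HasDerivAt x x' t) :
    HasDerivAt (fun s => reFunctional τ (x s * x s)) (2 * reFunctional τ (x t * x')) t := by
  have h := (reFunctional τ).hasFDerivAt.comp_hasDerivAt t (hx.mul hx)
  rw [map_add, reFunctional_mul_comm hτ x', ← two_mul] at h
  exact h

lemma IsSmoothCurve.continuousOn_log (hτ : IsFaithfulNormalTracialState τ) {γ : ℝ → A} {a b : A}
    (hγ : IsSmoothCurve γ a b) : ContinuousOn (fun s => CFC.log (γ s)) (Icc 0 1) := fun _ ht =>
  let ⟨_, hx, _⟩ := hγ.exists_log_deriv hτ ht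
  hx.continuousWithinAt

lemma twoNorm_log (c : A) :
    twoNorm τ (CFC.log c) = √(reFunctional τ (CFC.log c * CFC.log c)) :=
  twoNorm_of_isSelfAdjoint IsSelfAdjoint.log

lemma continuousOn_reFunctional_mul_self {x : ℝ → A} {s : Set ℝ} (hx : ContinuousOn x s) :
    ContinuousOn (fun u => reFunctional τ (x u * x u)) s :=
  (reFunctional τ).continuous.comp_continuousOn (hx.mul hx)

lemma IsSmoothCurve.continuousOn_twoNorm_log (hτ : IsFaithfulNormalTracialState τ) {γ : ℝ → A}
    {a b : A} (hγ : IsSmoothCurve γ a b) :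
    ContinuousOn (fun s => twoNorm τ (CFC.log (γ s))) (Icc 0 1) := by
  simp only [twoNorm_log]
  exact (continuousOn_reFunctional_mul_self (hγ.continuousOn_log hτ)).sqrt

/-- The function `t ↦ ‖log γ(t)‖₂` grows at most as fast as the arc length of `γ`. -/
lemma IsSmoothCurve.twoNorm_log_sub_le (hτ : IsFaithfulNormalTracialState τ) {γ : ℝ → A} {a b : A}
    (hγ : IsSmoothCurve γ a b) (h : length τ γ ≠ ⊤) {s t : ℝ} (hs : 0 ≤ s) (hst : s ≤ t)
    (ht : t ≤ 1) :
    twoNorm τ (CFC.log (γ t)) - twoNorm τ (CFC.log (γ s)) ≤ ∫ u in s..t, speed τ γ u := by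
  have hsub : Icc s t ⊆ Icc 0 1 := Icc_subset_Icc hs ht
  choose! x' hx' hle _ using fun u (hu : u ∈ Icc (0 : ℝ) 1) => hγ.exists_log_deriv hτ hu
  simp only [twoNorm_log] at hle ⊢
  refine sqrt_sub_sqrt_le_integral hst
    (q := fun u => reFunctional τ (CFC.log (γ u) * CFC.log (γ u)))
    (q' := fun u => 2 * reFunctional τ (CFC.log (γ u) * x' u))
    (fun u _ => reFunctional_mul_self_nonneg IsSelfAdjoint.log)
    (continuousOn_reFunctional_mul_self ((hγ.continuousOn_log hτ).mono hsub))
    (fun u hu => ?_) ((hγ.integrableOn_speed h).mono_set hsub) (speed_nonneg γ) fun u hu => ?_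
  · exact hasDerivAt_reFunctional_mul_self hτ
      ((hx' u (hsub (Ioo_subset_Icc_self hu))).hasDerivAt
        (Icc_mem_nhds (hs.trans_lt hu.1) (hu.2.trans_le ht)))
  · have := (le_abs_self _).trans (hle u (hsub (Ioo_subset_Icc_self hu)))
    linarith

lemma IsSmoothCurve.intervalIntegrable_speed {γ : ℝ → A} {a b : A} (hγ : IsSmoothCurve γ a b)
    (h : length τ γ ≠ ⊤) {s t : ℝ} (hs : 0 ≤ s) (hst : s ≤ t) (ht : t ≤ 1) :
    IntervalIntegrable (speed τ γ) volume s t := by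
  rw [intervalIntegrable_iff_integrableOn_Icc_of_le hst]
  exact (hγ.integrableOn_speed h).mono_set (Icc_subset_Icc hs ht)

lemma IsSmoothCurve.ofReal_twoNorm_log_le_length (hτ : IsFaithfulNormalTracialState τ) {γ : ℝ → A}
    {b : A} (hγ : IsSmoothCurve γ 1 b) :
    ENNReal.ofReal (twoNorm τ (CFC.log b)) ≤ length τ γ := by
  by_cases h : length τ γ = ⊤
  · rw [h]; exact le_top
  rw [hγ.length_eq_ofReal h]
  refine ENNReal.ofReal_le_ofReal ?_
  have := hγ.twoNorm_log_sub_le hτ h le_rfl zero_le_one le_rfl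
  rw [hγ.source, hγ.target, CFC.log_one] at this
  simpa [twoNorm] using this

/-- Along a curve from `1` of minimal length, `‖log γ(t)‖₂` is the arc length. -/
lemma IsSmoothCurve.twoNorm_log_sub_eq (hτ : IsFaithfulNormalTracialState τ) {γ : ℝ → A}
    {b : A} (hγ : IsSmoothCurve γ 1 b)
    (h : length τ γ = ENNReal.ofReal (twoNorm τ (CFC.log b))) {s t : ℝ} (hs : 0 ≤ s)
    (hst : s ≤ t) (ht : t ≤ 1) :
    twoNorm τ (CFC.log (γ t)) - twoNorm τ (CFC.log (γ s)) = ∫ u in s..t, speed τ γ u := by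
  have hfin : length τ γ ≠ ⊤ := h ▸ ENNReal.ofReal_ne_top
  have htot : ∫ u in (0 : ℝ)..1, speed τ γ u =
      twoNorm τ (CFC.log (γ 1)) - twoNorm τ (CFC.log (γ 0)) := by
    rw [hγ.length_eq_ofReal hfin, ENNReal.ofReal_eq_ofReal_iff
      (intervalIntegral.integral_nonneg zero_le_one fun u _ => speed_nonneg γ u)
      (twoNorm_nonneg _)] at h
    rw [h, hγ.source, hγ.target, CFC.log_one]
    simp [twoNorm]
  -- The inequalities on `[0, s]`, `[s, t]` and `[t, 1]` add up to an equality, so each of them is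
  -- one.
  have h1 := hγ.twoNorm_log_sub_le hτ hfin le_rfl hs (hst.trans ht)
  have h2 := hγ.twoNorm_log_sub_le hτ hfin hs hst ht
  have h3 := hγ.twoNorm_log_sub_le hτ hfin (hs.trans hst) ht le_rfl
  have i1 := hγ.intervalIntegrable_speed hfin le_rfl hs (hst.trans ht)
  have i2 := hγ.intervalIntegrable_speed hfin hs hst ht
  have i3 := hγ.intervalIntegrable_speed hfin (hs.trans hst) ht le_rfl
  rw [← intervalIntegral.integral_add_adjacent_intervals (i1.trans i2) i3,
    ← intervalIntegral.integral_add_adjacent_intervals i1 i2] at htot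
  linarith

lemma monotoneOn_twoNorm_log (hτ : IsFaithfulNormalTracialState τ) {γ : ℝ → A}
    {b : A} (hγ : IsSmoothCurve γ 1 b)
    (h : length τ γ = ENNReal.ofReal (twoNorm τ (CFC.log b))) :
    MonotoneOn (fun t => twoNorm τ (CFC.log (γ t))) (Icc 0 1) := fun s hs t ht hst => by
  have h1 := hγ.twoNorm_log_sub_eq hτ h hs.1 hst ht.2
  have h2 := intervalIntegral.integral_nonneg (μ := volume) hst fun u _ => speed_nonneg (τ := τ) γ u
  simp only
  linarith

lemma eq_zero_of_twoNorm_eq_zero (hτ : IsFaithfulNormalTracialState τ) {x : A}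
    (hx : IsSelfAdjoint x) (h : twoNorm τ x = 0) : x = 0 :=
  eq_zero_of_reFunctional_mul_self hτ hx (by rw [← twoNorm_sq hx, h]; ring)

/-- The logarithm of a curve from `1` of minimal length moves on a ray. -/
lemma IsSmoothCurve.log_eq_smul_of_length_eq (hτ : IsFaithfulNormalTracialState τ) {γ : ℝ → A}
    {b : A} (hγ : IsSmoothCurve γ 1 b)
    (h : length τ γ = ENNReal.ofReal (twoNorm τ (CFC.log b)))
    {t : ℝ} (ht : t ∈ Icc (0 : ℝ) 1) :
    CFC.log (γ t) = (twoNorm τ (CFC.log (γ t)) / twoNorm τ (CFC.log b)) • CFC.log b := by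
  by_cases hr : twoNorm τ (CFC.log (γ t)) = 0
  · rw [hr, zero_div, zero_smul]
    exact eq_zero_of_twoNorm_eq_zero hτ IsSelfAdjoint.log hr
  have hfin : length τ γ ≠ ⊤ := h ▸ ENNReal.ofReal_ne_top
  have hsub : Icc t 1 ⊆ Icc (0 : ℝ) 1 := Icc_subset_Icc_left ht.1
  have hsub' : Ioo t 1 ⊆ Icc (0 : ℝ) 1 := Ioo_subset_Icc_self.trans hsub
  -- By monotonicity the norm stays positive after `t`, so the direction `log γ / ‖log γ‖₂` is
  -- defined on all of `[t, 1]` and can be compared with its value at `1`.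
  have hpos : ∀ u ∈ Icc t 1, 0 < twoNorm τ (CFC.log (γ u)) := fun u hu =>
    ((twoNorm_nonneg _).lt_of_ne' hr).trans_le
      (monotoneOn_twoNorm_log hτ hγ h ht (hsub hu) hu.1)
  choose! x' hx' hle hrig using fun u (hu : u ∈ Icc (0 : ℝ) 1) => hγ.exists_log_deriv hτ hu
  have hxd : ∀ u ∈ Ioo t 1, HasDerivAt (fun s => CFC.log (γ s)) (x' u) u := fun u hu =>
    (hx' u (hsub' hu)).hasDerivAt (Icc_mem_nhds (ht.1.trans_lt hu.1) hu.2)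
  let r' : ℝ → ℝ := fun u => reFunctional τ (CFC.log (γ u) * x' u) / twoNorm τ (CFC.log (γ u))
  have hrd : ∀ u ∈ Ioo t 1, HasDerivAt (fun s => twoNorm τ (CFC.log (γ s))) (r' u) u := by
    intro u hu
    have hne := hpos u (Ioo_subset_Icc_self hu)
    have hq : reFunctional τ (CFC.log (γ u) * CFC.log (γ u)) ≠ 0 := by
      rw [← twoNorm_sq IsSelfAdjoint.log]
      positivity
    have := (hasDerivAt_reFunctional_mul_self hτ (hxd u hu)).sqrt hq
    simp only [twoNorm_log, r']
    rwa [mul_div_mul_left _ _ two_ne_zero] at this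
  have hrcont : ContinuousOn (fun s => twoNorm τ (CFC.log (γ s))) (Icc t 1) :=
    (hγ.continuousOn_twoNorm_log hτ).mono hsub
  have hae : ∀ᵐ u ∂volume.restrict (Ioo t 1), r' u = speed τ γ u := by
    refine ae_eq_of_sub_eq_integral ht.2 hrcont hrd ((hγ.integrableOn_speed hfin).mono_set hsub)
      (fun u hu => ?_) (hγ.twoNorm_log_sub_eq hτ h ht.1 ht.2 le_rfl)
    have hne := hpos u (Ioo_subset_Icc_self hu)
    rw [abs_div, abs_of_pos hne, div_le_iff₀ hne, mul_comm]
    exact hle u (hsub' hu)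
  have hconst := eq_of_hasDerivAt_of_ae_eq_zero ht.2
    (f := fun u => (twoNorm τ (CFC.log (γ u)))⁻¹ • CFC.log (γ u))
    ((hrcont.inv₀ fun u hu => (hpos u hu).ne').smul ((hγ.continuousOn_log hτ).mono hsub))
    (fun u hu => ((hrd u hu).inv (hpos u (Ioo_subset_Icc_self hu)).ne').smul (hxd u hu)) ?_
  · simp only [hγ.target] at hconst
    rw [div_eq_mul_inv, mul_smul, hconst, smul_inv_smul₀ hr]
  · rw [ae_restrict_iff' measurableSet_Ioo] at hae ⊢
    filter_upwards [hae] with u hu huI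
    have hne := (hpos u (Ioo_subset_Icc_self huI)).ne'
    have hr'u := hu huI
    -- The identity `r' = speed` is the equality case of Cauchy–Schwarz, so `(log γ)' = (r' / r) log
    -- γ`, and the two terms of the derivative of `r⁻¹ log γ` cancel.
    rw [hrig u (hsub' huI) hne (by rw [← hr'u, mul_div_cancel₀ _ hne]), hr'u, smul_smul,
      ← add_smul]
    convert zero_smul ℝ (CFC.log (γ u)) using 2
    rw [Pi.inv_apply]
    field_simp
    ring

end Minimality

/-! ### The curves `c ^ t`, and transport of the base point to `1`. -/

section Reduction

open MeasureTheory

variable {A : Type*} [CStarAlgebra A] [PartialOrder A] [StarOrderedRing A] {τ : A →ₚ[ℂ] ℂ}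

lemma mul_mul_mem_posInv {c k : A} (hc : c ∈ posInv A) (hk : k ∈ posInv A) :
    k * c * k ∈ posInv A :=
  ⟨hk.1.isSelfAdjoint.conjugate_nonneg hc.1, (hk.2.mul hc.2).mul hk.2⟩

lemma rpow_eq_exp_smul_log {c : A} (hc : c ∈ posInv A) (s : ℝ) :
    c ^ s = NormedSpace.exp (s • CFC.log c) := by
  have hspec : ∀ x ∈ spectrum ℝ c, 0 < x := fun x hx =>
    (isStrictlyPositive_of_mem_posInv hc).spectrum_pos hx
  have hlog : ContinuousOn Real.log (spectrum ℝ c) :=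
    Real.continuousOn_log.mono fun x hx => (hspec x hx).ne'
  rw [← CFC.real_exp_eq_normedSpace_exp ((IsSelfAdjoint.all s).smul IsSelfAdjoint.log), CFC.log,
    ← cfc_smul s Real.log c hlog, CFC.rpow_eq_cfc_real hc.1,
    ← cfc_comp' Real.exp (fun x => s • Real.log x) c
      Real.continuous_exp.continuousOn (hlog.const_smul s)]
  refine cfc_congr fun x hx => ?_
  simp only [Real.rpow_def_of_pos (hspec x hx), smul_eq_mul, mul_comm]

lemma contDiff_rpow {c : A} (hc : c ∈ posInv A) : ContDiff ℝ ∞ fun s : ℝ => c ^ s := by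
  simp only [rpow_eq_exp_smul_log hc]
  have hexp : ContDiff ℝ ∞ (NormedSpace.exp : A → A) :=
    contDiff_iff_contDiffAt.2 fun x => (NormedSpace.exp_analytic (𝕂 := ℝ) x).contDiffAt
  exact hexp.comp (contDiff_id.smul contDiff_const)

lemma hasDerivAt_rpow {c : A} (hc : c ∈ posInv A) (t : ℝ) :
    HasDerivAt (fun s : ℝ => c ^ s) (CFC.log c * c ^ t) t := by
  simp only [rpow_eq_exp_smul_log hc]
  exact hasDerivAt_exp_smul_const' (CFC.log c) t

lemma rpow_mul_ringInverse_rpow {c : A} (hc : c ∈ posInv A) (t : ℝ) :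
    c ^ t * Ring.inverse (c ^ t) = 1 :=
  Ring.mul_inverse_cancel _ (rpow_mem_posInv hc t).2

lemma isSmoothCurve_rpow {c : A} (hc : c ∈ posInv A) : IsSmoothCurve (fun s : ℝ => c ^ s) 1 c where
  mem t _ := rpow_mem_posInv hc t
  differentiable t _ := (hasDerivAt_rpow hc t).differentiableAt.differentiableWithinAt
  source := CFC.rpow_zero c hc.1
  target := CFC.rpow_one c hc.1

lemma speed_rpow {c : A} (hc : c ∈ posInv A) {t : ℝ} (ht : t ∈ Icc (0 : ℝ) 1) :
    speed τ (fun s : ℝ => c ^ s) t = twoNorm τ (CFC.log c) := by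
  rw [speed, (hasDerivAt_rpow hc t).hasDerivWithinAt.derivWithin (uniqueDiffOn_Icc_zero_one t ht),
    metricAt_eq, mul_assoc (CFC.log c), rpow_mul_ringInverse_rpow hc, mul_one, mul_assoc, mul_assoc,
    rpow_mul_ringInverse_rpow hc, mul_one, ← twoNorm_of_isSelfAdjoint IsSelfAdjoint.log]

lemma length_rpow {c : A} (hc : c ∈ posInv A) :
    length τ (fun s : ℝ => c ^ s) = ENNReal.ofReal (twoNorm τ (CFC.log c)) := by
  rw [length_eq_lintegral_speed,
    setLIntegral_congr_fun measurableSet_Icc fun t ht => by rw [speed_rpow hc ht]]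
  simp

lemma IsSmoothCurve.conj {γ : ℝ → A} {a b k : A} (hγ : IsSmoothCurve γ a b) (hk : k ∈ posInv A) :
    IsSmoothCurve (fun t => k * γ t * k) (k * a * k) (k * b * k) where
  mem t ht := mul_mul_mem_posInv (hγ.mem t ht) hk
  differentiable := (hγ.differentiable.const_mul k).mul_const k
  source := by rw [hγ.source]
  target := by rw [hγ.target]

/-- Conjugation by an element of `Σ` is an isometry of the trace metric. -/
lemma metricAt_conj (hτ : IsFaithfulNormalTracialState τ) {c k : A} (hc : c ∈ posInv A)
    (hk : k ∈ posInv A) (x y : A) :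
    metricAt τ (k * c * k) (k * x * k) (k * y * k) = metricAt τ c x y := by
  have hki : k * Ring.inverse k = 1 := Ring.mul_inverse_cancel _ hk.2
  have hik : Ring.inverse k * k = 1 := Ring.inverse_mul_cancel _ hk.2
  have hinv : Ring.inverse (k * c * k) = Ring.inverse k * Ring.inverse c * Ring.inverse k := by
    refine left_inv_eq_right_inv (Ring.inverse_mul_cancel _ (mul_mul_mem_posInv hc hk).2) ?_
    calc k * c * k * (Ring.inverse k * Ring.inverse c * Ring.inverse k)
        = k * (c * (k * Ring.inverse k) * Ring.inverse c) * Ring.inverse k := by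
          simp only [mul_assoc]
      _ = 1 := by rw [hki, mul_one, Ring.mul_inverse_cancel _ hc.2, mul_one, hki]
  rw [metricAt_eq, metricAt_eq, hinv]
  calc reFunctional τ (k * x * k * (Ring.inverse k * Ring.inverse c * Ring.inverse k) *
        (k * y * k) * (Ring.inverse k * Ring.inverse c * Ring.inverse k))
      = reFunctional τ (k * (x * (k * Ring.inverse k) * Ring.inverse c * (Ring.inverse k * k) * y *
          (k * Ring.inverse k) * Ring.inverse c) * Ring.inverse k) := by simp only [mul_assoc]
    _ = reFunctional τ (x * Ring.inverse c * y * Ring.inverse c) := by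
      rw [reFunctional_mul_comm hτ, ← mul_assoc, hik, hki, one_mul]
      simp only [mul_one]

lemma IsSmoothCurve.length_conj (hτ : IsFaithfulNormalTracialState τ) {γ : ℝ → A} {a b k : A}
    (hγ : IsSmoothCurve γ a b) (hk : k ∈ posInv A) :
    length τ (fun t => k * γ t * k) = length τ γ := by
  rw [length_eq_lintegral_speed, length_eq_lintegral_speed]
  refine setLIntegral_congr_fun measurableSet_Icc fun t ht => ?_
  have hd : derivWithin (fun t => k * γ t * k) (Icc 0 1) t = k * derivWithin γ (Icc 0 1) t * k :=
    (((hγ.hasDerivWithinAt ht).const_mul k).mul_const k).derivWithin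
      (uniqueDiffOn_Icc_zero_one t ht)
  simp only [speed, hd, metricAt_conj hτ (hγ.mem t ht) hk]

/-- The parameter is the fraction `‖log γ(t)‖₂ / ‖log b‖₂`, with exponentiation undoing the
logarithm. -/
lemma exists_reparametrization_of_length_eq (hτ : IsFaithfulNormalTracialState τ) {γ : ℝ → A}
    {b : A} (hγ : IsSmoothCurve γ 1 b)
    (h : length τ γ = ENNReal.ofReal (twoNorm τ (CFC.log b))) :
    ∃ f : ℝ → ℝ, MonotoneOn f (Icc 0 1) ∧ ContinuousOn f (Icc 0 1) ∧ f 0 = 0 ∧ f 1 = 1 ∧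
      ∀ t ∈ Icc (0 : ℝ) 1, γ t = b ^ f t := by
  have hb : b ∈ posInv A := hγ.target ▸ hγ.mem 1 (right_mem_Icc.2 zero_le_one)
  have hexp : ∀ t ∈ Icc (0 : ℝ) 1, γ t = NormedSpace.exp (CFC.log (γ t)) := fun t ht =>
    (CFC.exp_log _ (isStrictlyPositive_of_mem_posInv (hγ.mem t ht))).symm
  have hmono := monotoneOn_twoNorm_log hτ hγ h
  by_cases h0 : twoNorm τ (CFC.log b) = 0
  -- If `log b = 0`, monotonicity makes `γ` constantly `1`. The quotient `0 / 0 = 0` would violate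
  -- `f 1 = 1`, so the identity serves as parameter.
  · refine ⟨id, monotone_id.monotoneOn _, continuousOn_id, rfl, rfl, fun t ht => ?_⟩
    have hle : twoNorm τ (CFC.log (γ t)) ≤ twoNorm τ (CFC.log b) := by
      simpa only [hγ.target] using hmono ht (right_mem_Icc.2 zero_le_one) ht.2
    rw [hexp t ht, rpow_eq_exp_smul_log hb, eq_zero_of_twoNorm_eq_zero hτ IsSelfAdjoint.log h0,
      eq_zero_of_twoNorm_eq_zero hτ IsSelfAdjoint.log
        (le_antisymm (hle.trans h0.le) (twoNorm_nonneg _)), smul_zero]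
  · refine ⟨fun t => twoNorm τ (CFC.log (γ t)) / twoNorm τ (CFC.log b),
      fun s hs t ht hst => ?_, (hγ.continuousOn_twoNorm_log hτ).div_const _, ?_, ?_,
      fun t ht => ?_⟩
    · exact div_le_div_of_nonneg_right (hmono hs ht hst) (twoNorm_nonneg _)
    · simp [hγ.source, twoNorm]
    · simp only [hγ.target]
      exact div_self h0
    · rw [rpow_eq_exp_smul_log hb, ← hγ.log_eq_smul_of_length_eq hτ h ht]
      exact hexp t ht

lemma invSqrt_mul_self_mul_invSqrt {a : A} (ha : a ∈ posInv A) :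
    a ^ (-(1 / 2) : ℝ) * a * a ^ (-(1 / 2) : ℝ) = 1 :=
  CFC.conjugate_rpow_neg_one_half a (isStrictlyPositive_of_mem_posInv ha)

lemma sqrt_mul_invSqrt_conj {a : A} (ha : a ∈ posInv A) (x : A) :
    a ^ (1 / 2 : ℝ) * (a ^ (-(1 / 2) : ℝ) * x * a ^ (-(1 / 2) : ℝ)) * a ^ (1 / 2 : ℝ) = x := by
  have hs := isStrictlyPositive_of_mem_posInv ha
  calc _ = (a ^ (1 / 2 : ℝ) * a ^ (-(1 / 2) : ℝ)) * x *
        (a ^ (-(1 / 2) : ℝ) * a ^ (1 / 2 : ℝ)) := by simp only [mul_assoc]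
    _ = x := by rw [CFC.rpow_mul_rpow_neg _ hs, CFC.rpow_neg_mul_rpow _ hs, one_mul, mul_one]

lemma isSmoothCurve_geodesic {a b : A} (ha : a ∈ posInv A) (hb : b ∈ posInv A) :
    IsSmoothCurve (geodesic a b) a b := by
  have h := (isSmoothCurve_rpow (mul_mul_mem_posInv hb (rpow_mem_posInv ha (-(1 / 2))))).conj
    (rpow_mem_posInv ha (1 / 2))
  rwa [sqrt_mul_invSqrt_conj ha, ← invSqrt_mul_self_mul_invSqrt ha, sqrt_mul_invSqrt_conj ha] at h

lemma length_geodesic (hτ : IsFaithfulNormalTracialState τ) {a b : A} (ha : a ∈ posInv A)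
    (hb : b ∈ posInv A) :
    length τ (geodesic a b) = ENNReal.ofReal (twoNorm τ (CFC.log (conjInvSqrt a b))) := by
  have hh : conjInvSqrt a b ∈ posInv A := mul_mul_mem_posInv hb (rpow_mem_posInv ha _)
  rw [← length_rpow hh, ← (isSmoothCurve_rpow hh).length_conj hτ (rpow_mem_posInv ha (1 / 2))]
  rfl

lemma IsSmoothCurve.normalize {γ : ℝ → A} {a b : A} (hγ : IsSmoothCurve γ a b)
    (ha : a ∈ posInv A) :
    IsSmoothCurve (fun t => a ^ (-(1 / 2) : ℝ) * γ t * a ^ (-(1 / 2) : ℝ)) 1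
      (conjInvSqrt a b) := by
  have h := hγ.conj (rpow_mem_posInv ha (-(1 / 2)))
  rwa [invSqrt_mul_self_mul_invSqrt ha] at h

lemma IsSmoothCurve.ofReal_twoNorm_le_length (hτ : IsFaithfulNormalTracialState τ) {γ : ℝ → A}
    {a b : A} (hγ : IsSmoothCurve γ a b) (ha : a ∈ posInv A) :
    ENNReal.ofReal (twoNorm τ (CFC.log (conjInvSqrt a b))) ≤ length τ γ := by
  rw [← hγ.length_conj hτ (rpow_mem_posInv ha (-(1 / 2)))]
  exact (hγ.normalize ha).ofReal_twoNorm_log_le_length hτ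

end Reduction

end TraceGeometry

end

/-! ### The main theorem, for arbitrary end points. -/

theorem mainTheorem1 {A : Type*} [CStarAlgebra A] [PartialOrder A] [StarOrderedRing A]
    [WStarAlgebra A] (τ : A →ₚ[ℂ] ℂ) (hτ : TraceGeometry.IsFaithfulNormalTracialState τ)
    (a b : A) (ha : a ∈ TraceGeometry.posInv A) (hb : b ∈ TraceGeometry.posInv A) :
    -- `δ_{a,b}` is a smooth curve in `Σ` from `a` to `b`; it is even `C^∞`
    TraceGeometry.IsSmoothCurve (TraceGeometry.geodesic a b) a b ∧
    ContDiff ℝ ∞ (TraceGeometry.geodesic a b) ∧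
    -- no smooth curve in `Σ` from `a` to `b` is shorter
    (∀ γ : ℝ → A, TraceGeometry.IsSmoothCurve γ a b →
      TraceGeometry.length τ (TraceGeometry.geodesic a b) ≤ TraceGeometry.length τ γ) ∧
    -- every smooth curve of the same length is a monotone reparametrization of `δ_{a,b}`
    (∀ γ : ℝ → A, TraceGeometry.IsSmoothCurve γ a b →
      TraceGeometry.length τ γ = TraceGeometry.length τ (TraceGeometry.geodesic a b) →
      ∃ f : ℝ → ℝ, MonotoneOn f (Icc 0 1) ∧ ContinuousOn f (Icc 0 1) ∧ f 0 = 0 ∧ f 1 = 1 ∧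
        ∀ t ∈ Icc (0 : ℝ) 1, γ t = TraceGeometry.geodesic a b (f t)) ∧
    -- the distance formula
    TraceGeometry.dist τ a b = ENNReal.ofReal
      (TraceGeometry.twoNorm τ (CFC.log (TraceGeometry.conjInvSqrt a b))) := by
  have hgeo := TraceGeometry.isSmoothCurve_geodesic ha hb
  have hlen := TraceGeometry.length_geodesic hτ ha hb
  have hh : TraceGeometry.conjInvSqrt a b ∈ TraceGeometry.posInv A :=
    TraceGeometry.mul_mul_mem_posInv hb (TraceGeometry.rpow_mem_posInv ha _)
  refine ⟨hgeo, ?_, fun γ hγ => ?_, fun γ hγ h => ?_, le_antisymm ?_ ?_⟩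
  · exact (contDiff_const.mul (TraceGeometry.contDiff_rpow hh)).mul contDiff_const
  · rw [hlen]
    exact hγ.ofReal_twoNorm_le_length hτ ha
  · rw [hlen, ← hγ.length_conj hτ (TraceGeometry.rpow_mem_posInv ha (-(1 / 2)))] at h
    obtain ⟨f, hmono, hcont, hf0, hf1, hf⟩ :=
      TraceGeometry.exists_reparametrization_of_length_eq hτ (hγ.normalize ha) h
    refine ⟨f, hmono, hcont, hf0, hf1, fun t ht => ?_⟩
    rw [TraceGeometry.geodesic, ← hf t ht, TraceGeometry.sqrt_mul_invSqrt_conj ha]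
  · rw [← hlen]
    exact iInf₂_le (f := fun γ (_ : TraceGeometry.IsSmoothCurve γ a b) => TraceGeometry.length τ γ)
      _ hgeo
  · exact le_iInf₂ fun γ hγ => hγ.ofReal_twoNorm_le_length hτ ha
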